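/- Let $m>0$ and let $\eta=\mathrm{diag}(1,-1,-1,-1)$. Let $\mathcal W$ be the complex algebra of Wick polynomials in the free fields of mass $m$ on Minkowski space $h_{\mu\nu}=h_{\nu\mu}$ and $v_\mu$ (Bose), $u_\mu$ and $\tilde u_\mu$ (Fermi), and their derivatives: $\mathcal W$ is the graded-commutative algebra (Wick product) generated by the derivatives $\partial_{\kappa_1}\cdots\partial_{\kappa_n}\varphi$ of these fields, subject only to the symmetry of $h_{\mu\nu}$ and to $(\partial^2+m^2)\varphi=0$ and its derivatives. Let $\partial_\mu$ be the partial derivatives on $\mathcal W$. The ghost number $gh(M)$ of a monomial is its degree in $\tilde u$ minus its degree in $u$. The gauge variation $d_Q:\mathcal W\to\mathcal W$ is the linear map that commutes with $\partial_\mu$, satisfies $d_Q(MN)=(d_QM)N+(-1)^{gh(M)}M\,d_QN$, and $$d_Qh_{\mu\nu}=-\tfrac i2\left(\partial_\mu u_\nu+\partial_\nu u_\mu-\eta_{\mu\nu}\partial_\rho u^\rho\right),\quad d_Qu_\mu=0,\quad d_Q\tilde u_\mu=i\left(\partial^\nu h_{\mu\nu}+m v_\mu\right),\quad d_Qv_\mu=-\tfrac{im}2u_\mu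 ;$$ it lowers the ghost number by one. Two elements of $\mathcal W$ are called equivalent if their difference is of the form $d_QB+\partial_\mu B^\mu$ with $gh(B)=1$ and $gh(B^\mu)=0$. Put $h\equiv h^\mu{}_\mu$, $\Phi\equiv\frac12h$ and $H_{\mu\nu}\equiv h_{\mu\nu}-\frac12\eta_{\mu\nu}\Phi$ (so $H$ is symmetric and traceless and $h_{\mu\nu}=H_{\mu\nu}+\frac12\eta_{\mu\nu}\Phi$). **Proposition.** (i) The expression $$\begin{aligned}T^{(b)}\equiv{}&-H^{\mu\nu}(\partial_\mu v_\rho)(\partial_\nu v^\rho)+2H^{\mu\nu}(\partial_\mu v_\nu)(\partial_\rho v^\rho)-2H^{\mu\nu}(\partial_\mu v_\rho)(\partial^\rho v_\nu)\\ &+m\Big[H^{\mu\nu}(\partial_\rho H_{\mu\nu})v^\rho-2H^{\mu\nu}(\partial_\nu H_{\mu\rho})v^\rho+H^{\mu\nu}(\partial_\mu\Phi)v_\nu+(\partial_\rho v^\rho)u_\mu\tilde u^\mu-\tfrac12(\partial_\mu v_\nu)u^\mu\tilde u^\nu\\ &\qquad+(\partial_\nu v_\mu)u^\mu\tilde u^\nu+v^\nu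 u^\mu(\partial_\nu\tilde u_\mu)+v_\mu u^\mu(\partial^\nu\tilde u_\nu)-\tfrac12v^\nu u^\mu(\partial_\mu\tilde u_\nu)+2v_\mu v_\nu(\partial^\mu v^\nu)\Big]\\ &+m^2\Big(-\tfrac13H^{\mu\nu}H_{\mu\rho}H_\nu{}^\rho-H^{\mu\nu}u_\mu\tilde u_\nu+\tfrac32H^{\mu\nu}v_\mu v_\nu\Big)\end{aligned}$$ is equivalent to $$\begin{aligned}T={}&-h^{\mu\nu}(\partial_\mu v_\rho)(\partial_\nu v^\rho)+2h^{\mu\nu}(\partial_\mu v_\nu)(\partial^\rho v_\rho)-\tfrac12h(\partial_\rho v^\rho)^2-2h^{\mu\nu}(\partial_\mu v_\rho)(\partial^\rho v_\nu)+\tfrac12h(\partial_\mu v_\rho)(\partial^\rho v^\mu)\\ &+m\Big[h^{\mu\nu}(\partial_\rho h_{\mu\nu})v^\rho-\tfrac12h(\partial_\rho h)v^\rho-2h^{\mu\nu}(\partial_\nu h_{\mu\rho})v^\rho+h_{\rho\nu}(\partial^\nu h)v^\rho+\tfrac12h(\partial^\mu h_{\mu\rho})v^\rho\\ &\qquad+(\partial_\rho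 v^\rho)u_\mu\tilde u^\mu-\tfrac12(\partial_\mu v_\nu)u^\mu\tilde u^\nu+(\partial_\nu v_\mu)u^\mu\tilde u^\nu+v^\nu u^\mu(\partial_\nu\tilde u_\mu)+v_\mu u^\mu(\partial^\nu\tilde u_\nu)\\ &\qquad-\tfrac12v^\nu u^\mu(\partial_\mu\tilde u_\nu)+2v_\mu v_\nu(\partial^\mu v^\nu)\Big]\\ &+m^2\Big(-\tfrac13h^{\mu\nu}h_{\mu\rho}h_\nu{}^\rho+\tfrac14h^{\mu\nu}h_{\mu\nu}h-\tfrac1{24}h^3-h^{\mu\nu}u_\mu\tilde u_\nu+\tfrac14h\,u^\mu\tilde u_\mu+\tfrac32h^{\mu\nu}v_\mu v_\nu-\tfrac14h\,v^\mu v_\mu\Big).\end{aligned}$$ (ii) This $T$ satisfies the first-order gauge invariance condition $d_QT=i\,\partial^\mu T^{(b)}_\mu$ with $$\begin{aligned}T^{(b)}_\mu={}&u^\nu\Big\{(\partial_\mu v_\rho)(\partial_\nu v^\rho)-(\partial_\nu v_\mu)(\partial_\rho v^\rho)-\tfrac12(\partial_\mu v_\nu)(\partial_\rho v^\rho)+(\partial_\nu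 v_\rho)(\partial^\rho v_\mu)+\tfrac12(\partial_\mu v_\rho)(\partial^\rho v_\nu)\\ &\qquad+\tfrac12v_\nu(\partial_\mu\partial_\rho v^\rho)-\tfrac12v^\rho(\partial_\mu\partial_\rho v_\nu)\\ &\quad+m\Big[-(\partial^\rho h_{\mu\rho})v_\nu-h_{\mu\nu}(\partial^\rho v_\rho)+h_{\mu\rho}(\partial_\nu v^\rho)+h_{\nu\rho}(\partial^\rho v_\mu)-\tfrac12h(\partial_\nu v_\mu)-(\partial_\rho h_{\mu\nu})v^\rho+(\partial_\nu h_{\mu\rho})v^\rho\\ &\qquad+\tfrac12(\partial_\mu h_{\nu\rho})v^\rho-\tfrac14(\partial_\mu h)v_\nu-\tfrac12(\partial_\nu h)v_\mu+\tfrac14h(\partial_\mu v_\nu)-\tfrac12h_{\nu\rho}(\partial_\mu v^\rho)\Big]\\ &\quad+m^2\Big(-\tfrac52v_\mu v_\nu+h_{\mu\rho}h_\nu{}^\rho-\tfrac12h_{\mu\nu}h\Big)\Big\}\\ &+u_\mu\Big\{-\tfrac12(\partial_\nu v_\rho)(\partial^\nu v^\rho)+\tfrac12(\partial_\rho v^\rho)^2-\tfrac12(\partial_\nu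 v_\rho)(\partial^\rho v^\nu)\\ &\quad+m\Big[-h^{\rho\sigma}(\partial_\rho v_\sigma)+\tfrac12h(\partial_\rho v^\rho)+\tfrac12(\partial_\rho h)v^\rho-\tfrac12(\partial^\rho h_{\rho\sigma})v^\sigma\Big]+m^2\Big(-\tfrac14h_{\rho\sigma}h^{\rho\sigma}+\tfrac18h^2+\tfrac12v^\nu v_\nu\Big)\Big\}\\ &+m(\partial^\rho u^\nu)h_{\mu\rho}v_\nu-\tfrac12(\partial_\mu u_\nu)\Big[v^\nu(\partial^\rho v_\rho)-v_\rho(\partial^\rho v^\nu)-m\big(h^{\nu\rho}v_\rho-\tfrac12h v^\nu\big)\Big]-\tfrac34m^2u_\mu u_\nu\tilde u^\nu .\end{aligned}$$ -/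

import Mathlib

open scoped BigOperators

noncomputable section

namespace MassiveGravity

/-- The free fields: the symmetric tensor `h_{μν}`, the Fermi ghosts `u_μ`, `ũ_μ` and the bosonic
ghost `v_μ`. All Lorentz indices are lower indices. -/
inductive Fld where
  | h (μ ν : Fin 4)
  | u (μ : Fin 4)
  | ut (μ : Fin 4)
  | v (μ : Fin 4)

namespace Fld

/-- The ghost number: degree in `ũ` minus degree in `u`. -/
def gh : Fld → ℤ
  | h _ _ => 0
  | u _ => -1
  | ut _ => 1
  | v _ => 0

/-- The Fermi fields are `u` and `ũ`. -/
def fermi : Fld → Bool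
  | h _ _ => false
  | u _ => true
  | ut _ => true
  | v _ => false

/-- The sign `(-1)^gh`. -/
def sgn (φ : Fld) : ℂ := if φ.fermi then -1 else 1

/-- The sign picked up when two fields are interchanged in a Wick product. -/
def koszul (φ ψ : Fld) : ℂ := if φ.fermi && ψ.fermi then -1 else 1

end Fld

/-- `⟨φ, {κ₁, …, κₙ}⟩` stands for the iterated derivative `∂_{κ₁} ⋯ ∂_{κₙ} φ`; as partial derivatives
commute, only the multiset of the directions matters. -/
structure Jet where
  fld : Fld
  der : Multiset (Fin 4)

/-- The diagonal entries of the Minkowski metric. -/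
def eta : Fin 4 → ℂ := ![1, -1, -1, -1]

/-- The Minkowski metric `η_{μν}`. -/
def metric (μ ν : Fin 4) : ℂ := Matrix.diagonal eta μ ν

/-- The relations between the field derivatives under the Wick product: graded commutativity,
symmetry of `h_{μν}`, and the Klein-Gordon equation `(∂² + m²) φ = 0` together with all its
derivatives. -/
inductive WickRel (m : ℝ) : FreeAlgebra ℂ Jet → FreeAlgebra ℂ Jet → Prop
  | comm (a b : Jet) : WickRel m (FreeAlgebra.ι ℂ a * FreeAlgebra.ι ℂ b)
      (Fld.koszul a.fld b.fld • (FreeAlgebra.ι ℂ b * FreeAlgebra.ι ℂ a))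
  | symm (μ ν : Fin 4) (I : Multiset (Fin 4)) :
      WickRel m (FreeAlgebra.ι ℂ ⟨.h μ ν, I⟩) (FreeAlgebra.ι ℂ ⟨.h ν μ, I⟩)
  | kleinGordon (φ : Fld) (I : Multiset (Fin 4)) :
      WickRel m (∑ μ, eta μ • FreeAlgebra.ι ℂ ⟨φ, μ ::ₘ μ ::ₘ I⟩
        + ((m : ℂ) ^ 2) • FreeAlgebra.ι ℂ ⟨φ, I⟩) 0

/-- The algebra of Wick polynomials (at a point of Minkowski space) in the free fields of mass `m`
and their derivatives, with the Wick product as multiplication: the Wick product of free fields is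
graded commutative, and the differentiated fields satisfy no relations except those coming from the
symmetry of `h_{μν}` and the Klein-Gordon equation. -/
def Wick (m : ℝ) : Type := RingQuot (WickRel m)

instance (m : ℝ) : Ring (Wick m) := inferInstanceAs (Ring (RingQuot (WickRel m)))

instance (m : ℝ) : Algebra ℂ (Wick m) := inferInstanceAs (Algebra ℂ (RingQuot (WickRel m)))

/-- The quotient map onto the algebra of Wick polynomials. -/
def mk (m : ℝ) : FreeAlgebra ℂ Jet →ₐ[ℂ] Wick m := RingQuot.mkAlgHom ℂ (WickRel m)

theorem mk_rel {m : ℝ} {x y : FreeAlgebra ℂ Jet} (h : WickRel m x y) : mk m x = mk m y :=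
  RingQuot.mkAlgHom_rel ℂ h

/-- The universal property of the algebra of Wick polynomials. -/
def liftHom (m : ℝ) {A : Type} [Ring A] [Algebra ℂ A] (f : FreeAlgebra ℂ Jet →ₐ[ℂ] A)
    (hf : ∀ ⦃x y⦄, WickRel m x y → f x = f y) : Wick m →ₐ[ℂ] A :=
  RingQuot.liftAlgHom ℂ ⟨f, hf⟩

theorem liftHom_mk (m : ℝ) {A : Type} [Ring A] [Algebra ℂ A] (f : FreeAlgebra ℂ Jet →ₐ[ℂ] A)
    (hf : ∀ ⦃x y⦄, WickRel m x y → f x = f y) (x : FreeAlgebra ℂ Jet) :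
    liftHom m f hf (mk m x) = f x :=
  RingQuot.liftAlgHom_mkAlgHom_apply ℂ f hf x

/-- The field derivative described by a jet, as a Wick monomial. -/
def gen {m : ℝ} (a : Jet) : Wick m := mk m (FreeAlgebra.ι ℂ a)

theorem gen_comm {m : ℝ} (a b : Jet) :
    (gen a * gen b : Wick m) = Fld.koszul a.fld b.fld • (gen b * gen a) := by
  simpa only [gen, map_mul, map_smul] using mk_rel (WickRel.comm (m := m) a b)

theorem gen_symm {m : ℝ} (μ ν : Fin 4) (I : Multiset (Fin 4)) :
    (gen ⟨.h μ ν, I⟩ : Wick m) = gen ⟨.h ν μ, I⟩ :=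
  mk_rel (WickRel.symm (m := m) μ ν I)

theorem gen_kleinGordon {m : ℝ} (φ : Fld) (I : Multiset (Fin 4)) :
    ∑ μ, eta μ • (gen ⟨φ, μ ::ₘ μ ::ₘ I⟩ : Wick m) + ((m : ℂ) ^ 2) • gen ⟨φ, I⟩ = 0 := by
  simpa only [gen, map_add, map_sum, map_smul, map_zero] using
    mk_rel (WickRel.kleinGordon (m := m) φ I)

/-- Auxiliary: the algebra homomorphism `M ↦ (M, ∂_κ M; 0, M)` into triangular matrices, which
encodes the Leibniz rule for the derivation `∂_κ`. -/
def pdHom (m : ℝ) (κ : Fin 4) : Wick m →ₐ[ℂ] Matrix (Fin 2) (Fin 2) (Wick m) :=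
  liftHom m (FreeAlgebra.lift ℂ fun a : Jet =>
    !![gen a, gen ⟨a.fld, κ ::ₘ a.der⟩; 0, gen a]) (by
    intro x y hxy
    cases hxy with
    | comm a b =>
      simp only [map_mul, map_smul, FreeAlgebra.lift_ι_apply, Matrix.mul_fin_two]
      ext i j
      fin_cases i <;> fin_cases j
      · simpa using gen_comm a b
      · have h1 := gen_comm (m := m) a ⟨b.fld, κ ::ₘ b.der⟩
        have h2 := gen_comm (m := m) ⟨a.fld, κ ::ₘ a.der⟩ b
        simp only [] at h1 h2
        simp [h1, h2, smul_add, add_comm]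
      · simp
      · simpa using gen_comm a b
    | symm μ ν I =>
      simp only [FreeAlgebra.lift_ι_apply]
      rw [gen_symm μ ν I, gen_symm μ ν (κ ::ₘ I)]
    | kleinGordon φ I =>
      simp only [map_add, map_sum, map_smul, map_zero, FreeAlgebra.lift_ι_apply]
      have h1 := gen_kleinGordon (m := m) φ I
      have h2 := gen_kleinGordon (m := m) φ (κ ::ₘ I)
      have h3 : ∀ μ : Fin 4, κ ::ₘ μ ::ₘ μ ::ₘ I = μ ::ₘ μ ::ₘ κ ::ₘ I := fun μ => by
        rw [Multiset.cons_swap κ μ, Multiset.cons_swap κ μ]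
      ext i j
      fin_cases i <;> fin_cases j
      · simpa [Matrix.sum_apply] using h1
      · simpa [Matrix.sum_apply, h3] using h2
      · simp [Matrix.sum_apply]
      · simpa [Matrix.sum_apply] using h1)

/-- The partial derivative `∂_κ` on Wick polynomials. -/
def pd {m : ℝ} (κ : Fin 4) : Wick m →ₗ[ℂ] Wick m :=
  Matrix.entryLinearMap ℂ (Wick m) 0 1 ∘ₗ (pdHom m κ).toLinearMap

/-- The gauge variation of a differentiated field, from
`d_Q h_{μν} = -(i/2) (∂_μ u_ν + ∂_ν u_μ - η_{μν} ∂_ρ u^ρ)`, `d_Q u_μ = 0`,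
`d_Q ũ_μ = i (∂^ν h_{μν} + m v_μ)`, `d_Q v_μ = -(i m/2) u_μ` by differentiation. -/
def varJet {m : ℝ} : Jet → Wick m
  | ⟨.h μ ν, I⟩ => (-(Complex.I / 2)) • (gen ⟨.u ν, μ ::ₘ I⟩ + gen ⟨.u μ, ν ::ₘ I⟩
      - metric μ ν • ∑ ρ, eta ρ • gen ⟨.u ρ, ρ ::ₘ I⟩)
  | ⟨.u _, _⟩ => 0
  | ⟨.ut μ, I⟩ => Complex.I • (∑ ν, eta ν • gen ⟨.h μ ν, ν ::ₘ I⟩ + (m : ℂ) • gen ⟨.v μ, I⟩)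
  | ⟨.v μ, I⟩ => (-(Complex.I * m / 2)) • gen ⟨.u μ, I⟩

theorem gen_mul_varJet {m : ℝ} (c a : Jet) :
    (gen c * varJet a : Wick m)
      = (if c.fld.fermi && !a.fld.fermi then (-1 : ℂ) else 1) • (varJet a * gen c) := by
  have hu : ∀ μ I, (gen c * gen ⟨.u μ, I⟩ : Wick m) = c.fld.sgn • (gen ⟨.u μ, I⟩ * gen c) :=
    fun μ I => by rw [gen_comm]; simp [Fld.koszul, Fld.sgn, show (Fld.u μ).fermi = true from rfl]
  have hh : ∀ μ ν I, (gen c * gen ⟨.h μ ν, I⟩ : Wick m) = gen ⟨.h μ ν, I⟩ * gen c :=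
    fun μ ν I => by rw [gen_comm]; simp [Fld.koszul, show (Fld.h μ ν).fermi = false from rfl]
  have hv : ∀ μ I, (gen c * gen ⟨.v μ, I⟩ : Wick m) = gen ⟨.v μ, I⟩ * gen c :=
    fun μ I => by rw [gen_comm]; simp [Fld.koszul, show (Fld.v μ).fermi = false from rfl]
  have hs : (if c.fld.fermi && !false then (-1 : ℂ) else 1) = c.fld.sgn := by simp [Fld.sgn]
  have ht : (if c.fld.fermi && !true then (-1 : ℂ) else 1) = 1 := by simp
  have f1 : ∀ μ ν, (Fld.h μ ν).fermi = false := fun _ _ => rfl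
  have f2 : ∀ μ, (Fld.u μ).fermi = true := fun _ => rfl
  have f3 : ∀ μ, (Fld.ut μ).fermi = true := fun _ => rfl
  have f4 : ∀ μ, (Fld.v μ).fermi = false := fun _ => rfl
  obtain ⟨φ, I⟩ := a
  cases φ <;>
    simp only [f1, f2, f3, f4, hs, ht, varJet, mul_add, add_mul, mul_sub, sub_mul, mul_smul_comm,
      smul_mul_assoc, Finset.mul_sum, Finset.sum_mul, hu, hh, hv, mul_zero, zero_mul, smul_zero,
      one_smul, smul_add, smul_sub, Finset.smul_sum, smul_comm c.fld.sgn]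

/-- Auxiliary: the algebra homomorphism `M ↦ ((-1)^gh(M) M, d_Q M; 0, M)` into triangular matrices,
which encodes the graded Leibniz rule for `d_Q`. -/
def dQHom (m : ℝ) : Wick m →ₐ[ℂ] Matrix (Fin 2) (Fin 2) (Wick m) :=
  liftHom m (FreeAlgebra.lift ℂ fun a : Jet =>
    !![a.fld.sgn • gen a, varJet a; 0, gen a]) (by
    intro x y hxy
    cases hxy with
    | comm a b =>
      simp only [map_mul, map_smul, FreeAlgebra.lift_ι_apply, Matrix.mul_fin_two]
      ext i j
      fin_cases i <;> fin_cases j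
      · simp [gen_comm a b, smul_smul, mul_comm, mul_assoc]
      · have h1 := gen_mul_varJet (m := m) a b
        have h2 := gen_mul_varJet (m := m) b a
        cases ha : a.fld.fermi <;> cases hb : b.fld.fermi <;>
          simp [h1, h2, Fld.sgn, Fld.koszul, ha, hb, add_comm]
      · simp
      · simpa using gen_comm a b
    | symm μ ν I =>
      simp only [FreeAlgebra.lift_ι_apply]
      have h1 : metric μ ν = metric ν μ := by
        rcases eq_or_ne μ ν with h | h
        · rw [h]
        · simp [metric, h, h.symm]
      rw [gen_symm μ ν I]
      simp only [varJet, h1, add_comm (gen (m := m) ⟨Fld.u ν, μ ::ₘ I⟩)]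
      rfl
    | kleinGordon φ I =>
      simp only [map_add, map_sum, map_smul, map_zero, FreeAlgebra.lift_ι_apply]
      have h1 := gen_kleinGordon (m := m) φ I
      have hsw : ∀ (κ μ : Fin 4), κ ::ₘ μ ::ₘ μ ::ₘ I = μ ::ₘ μ ::ₘ κ ::ₘ I := fun κ μ => by
        rw [Multiset.cons_swap κ μ, Multiset.cons_swap κ μ]
      have h2 : ∑ μ, eta μ • (varJet ⟨φ, μ ::ₘ μ ::ₘ I⟩ : Wick m)
          + ((m : ℂ) ^ 2) • varJet ⟨φ, I⟩ = 0 := by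
        have e := gen_kleinGordon (m := m)
        cases φ with
        | h μ ν =>
          have e1 := e (.u ν) (μ ::ₘ I)
          have e2 := e (.u μ) (ν ::ₘ I)
          have e3 := fun ρ => e (.u ρ) (ρ ::ₘ I)
          have f0 := e3 0
          have f1 := e3 1
          have f2 := e3 2
          have f3 := e3 3
          simp only [Fin.sum_univ_four] at e1 e2 f0 f1 f2 f3
          simp only [varJet, Fin.sum_univ_four, hsw μ, hsw ν, hsw 0, hsw 1, hsw 2, hsw 3]
          linear_combination (norm := module) (-(Complex.I / 2)) • (e1 + e2 - metric μ ν •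
            (eta 0 • f0 + eta 1 • f1 + eta 2 • f2 + eta 3 • f3))
        | u μ => simp [varJet]
        | ut μ =>
          have e1 := e (.v μ) I
          have e3 := fun ρ => e (.h μ ρ) (ρ ::ₘ I)
          have f0 := e3 0
          have f1 := e3 1
          have f2 := e3 2
          have f3 := e3 3
          simp only [Fin.sum_univ_four] at e1 f0 f1 f2 f3
          simp only [varJet, Fin.sum_univ_four, hsw 0, hsw 1, hsw 2, hsw 3]
          linear_combination (norm := module) Complex.I • (eta 0 • f0 + eta 1 • f1 + eta 2 • f2
            + eta 3 • f3 + (m : ℂ) • e1)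
        | v μ =>
          have e1 := e (.u μ) I
          simp only [varJet, Fin.sum_univ_four] at e1 ⊢
          linear_combination (norm := module) (-(Complex.I * m / 2)) • e1
      ext i j
      fin_cases i <;> fin_cases j
      · have h3 := congrArg (fun w => φ.sgn • w) h1
        simpa [Matrix.sum_apply, smul_add, Finset.smul_sum, smul_comm φ.sgn] using h3
      · simpa [Matrix.sum_apply] using h2
      · simp [Matrix.sum_apply]
      · simpa [Matrix.sum_apply] using h1)

/-- The gauge variation `d_Q` on Wick polynomials. -/
def dQ {m : ℝ} : Wick m →ₗ[ℂ] Wick m :=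
  Matrix.entryLinearMap ℂ (Wick m) 0 1 ∘ₗ (dQHom m).toLinearMap

/-- The Wick polynomials of ghost number `k`: linear combinations of Wick monomials in which the
degree in `ũ` exceeds the degree in `u` by `k`. -/
def ghost {m : ℝ} (k : ℤ) : Submodule ℂ (Wick m) :=
  Submodule.span ℂ {w | ∃ l : List Jet, (l.map fun a => a.fld.gh).sum = k ∧ w = (l.map gen).prod}

/-! The defining properties of `∂_κ` and `d_Q`. -/

theorem wick_induction {m : ℝ} {P : Wick m → Prop} (hc : ∀ c : ℂ, P (algebraMap ℂ _ c))
    (hg : ∀ a, P (gen a)) (hm : ∀ x y, P x → P y → P (x * y))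
    (ha : ∀ x y, P x → P y → P (x + y)) (w : Wick m) : P w := by
  obtain ⟨x, rfl⟩ : ∃ x, mk m x = w := RingQuot.mkAlgHom_surjective ℂ (WickRel m) w
  induction x using FreeAlgebra.induction with
  | grade0 c => rw [AlgHom.commutes]; exact hc c
  | grade1 a => exact hg a
  | mul x y hx hy => rw [map_mul]; exact hm _ _ hx hy
  | add x y hx hy => rw [map_add]; exact ha _ _ hx hy

theorem pdHom_gen (m : ℝ) (κ : Fin 4) (a : Jet) :
    pdHom m κ (gen a) = !![gen a, gen ⟨a.fld, κ ::ₘ a.der⟩; 0, gen a] := by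
  rw [pdHom, gen, liftHom_mk, FreeAlgebra.lift_ι_apply]
  rfl

theorem dQHom_gen (m : ℝ) (a : Jet) :
    dQHom m (gen a) = !![a.fld.sgn • gen a, varJet a; 0, gen a] := by
  rw [dQHom, gen, liftHom_mk, FreeAlgebra.lift_ι_apply]
  rfl

theorem pdHom_diag (m : ℝ) (κ : Fin 4) (w : Wick m) :
    pdHom m κ w 0 0 = w ∧ pdHom m κ w 1 0 = 0 ∧ pdHom m κ w 1 1 = w := by
  induction w using wick_induction with
  | hc c => simp [Matrix.algebraMap_matrix_apply]
  | hg a => simp [pdHom_gen]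
  | hm x y hx hy => simp [Matrix.mul_apply, hx, hy]
  | ha x y hx hy => simp [hx, hy]

theorem dQHom_diag (m : ℝ) (w : Wick m) : dQHom m w 1 0 = 0 ∧ dQHom m w 1 1 = w := by
  induction w using wick_induction with
  | hc c => simp [Matrix.algebraMap_matrix_apply]
  | hg a => simp [dQHom_gen]
  | hm x y hx hy => simp [Matrix.mul_apply, hx, hy]
  | ha x y hx hy => simp [hx, hy]

theorem pd_gen {m : ℝ} (κ : Fin 4) (a : Jet) :
    pd κ (gen a : Wick m) = gen ⟨a.fld, κ ::ₘ a.der⟩ := by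
  simp [pd, pdHom_gen]

/-- The Leibniz rule for `∂_κ`. -/
theorem pd_mul {m : ℝ} (κ : Fin 4) (x y : Wick m) : pd κ (x * y) = pd κ x * y + x * pd κ y := by
  simp [pd, Matrix.mul_apply, pdHom_diag, add_comm]

theorem dQ_gen {m : ℝ} (a : Jet) : dQ (gen a : Wick m) = varJet a := by
  simp [dQ, dQHom_gen]

/-- `d_Q` commutes with the partial derivatives of the fields. -/
theorem pd_varJet {m : ℝ} (κ : Fin 4) (a : Jet) :
    pd κ (varJet a : Wick m) = varJet ⟨a.fld, κ ::ₘ a.der⟩ := by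
  obtain ⟨φ, I⟩ := a
  cases φ <;> simp [varJet, pd_gen, Multiset.cons_swap κ]

theorem dQHom_ghost {m : ℝ} {k : ℤ} {x : Wick m} (hx : x ∈ ghost k) :
    dQHom m x 0 0 = ((-1 : ℂ) ^ k) • x := by
  induction hx using Submodule.span_induction with
  | mem x hx =>
    obtain ⟨l, rfl, rfl⟩ := hx
    induction l with
    | nil => simp
    | cons a l ih =>
      have hs : a.fld.sgn = (-1 : ℂ) ^ a.fld.gh := by
        cases a.fld <;> simp [Fld.sgn, Fld.fermi, Fld.gh]
      simp only [List.map_cons, List.prod_cons, List.sum_cons, map_mul, Matrix.mul_apply,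
        Fin.sum_univ_two, dQHom_diag, ih, mul_zero, add_zero, dQHom_gen]
      rw [zpow_add₀ (by norm_num), ← hs]
      simp [smul_smul, mul_comm]
  | zero => simp
  | add x y _ _ hx hy => simp [hx, hy]
  | smul c x _ hx => simp [hx, smul_comm c]

/-- The graded Leibniz rule for `d_Q`. -/
theorem dQ_mul {m : ℝ} {k : ℤ} {x : Wick m} (hx : x ∈ ghost k) (y : Wick m) :
    dQ (x * y) = dQ x * y + ((-1 : ℂ) ^ k) • (x * dQ y) := by
  simp [dQ, Matrix.mul_apply, dQHom_diag, dQHom_ghost hx, add_comm]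

/-! The fields. -/

/-- The field `h_{μν}`. -/
def fh {m : ℝ} (μ ν : Fin 4) : Wick m := gen ⟨.h μ ν, 0⟩

/-- The Fermi ghost `u_μ`. -/
def fu {m : ℝ} (μ : Fin 4) : Wick m := gen ⟨.u μ, 0⟩

/-- The Fermi ghost `ũ_μ`. -/
def fut {m : ℝ} (μ : Fin 4) : Wick m := gen ⟨.ut μ, 0⟩

/-- The bosonic ghost `v_μ`. -/
def fv {m : ℝ} (μ : Fin 4) : Wick m := gen ⟨.v μ, 0⟩

/-- Contraction of a pair of lower indices with the Minkowski metric: if `f μ` stands for an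
expression with the index `μ` twice in lower position, this is the sum with one of the two raised. -/
def contr {m : ℝ} (f : Fin 4 → Wick m) : Wick m := ∑ μ, eta μ • f μ

/-- Contraction of two pairs of indices. -/
def contr2 {m : ℝ} (f : Fin 4 → Fin 4 → Wick m) : Wick m := contr fun μ => contr fun ν => f μ ν

/-- Contraction of three pairs of indices. -/
def contr3 {m : ℝ} (f : Fin 4 → Fin 4 → Fin 4 → Wick m) : Wick m :=
  contr fun μ => contr fun ν => contr fun ρ => f μ ν ρ

/-- The trace `h = h^μ_μ`. -/
def trh {m : ℝ} : Wick m := contr fun μ => fh μ μ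

/-- The scalar field `Φ`, so that `h = 2 Φ`. -/
def fPhi {m : ℝ} : Wick m := ((1 : ℂ) / 2) • trh

/-- The traceless field `H_{μν}`, so that `h_{μν} = H_{μν} + ½ η_{μν} Φ`. -/
def fH {m : ℝ} (μ ν : Fin 4) : Wick m := fh μ ν - ((1 : ℂ) / 2 * metric μ ν) • fPhi

theorem fh_symm {m : ℝ} (μ ν : Fin 4) : (fh μ ν : Wick m) = fh ν μ := gen_symm μ ν 0

theorem fH_traceless {m : ℝ} : contr (fun μ => (fH μ μ : Wick m)) = 0 := by
  simp only [contr, fH, fPhi, trh, metric, eta, Fin.sum_univ_four, Matrix.diagonal_apply_eq,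
    Matrix.cons_val]
  module

theorem fh_eq {m : ℝ} (μ ν : Fin 4) :
    (fh μ ν : Wick m) = fH μ ν + ((1 : ℂ) / 2 * metric μ ν) • fPhi := by
  simp [fH]

theorem kleinGordon {m : ℝ} (φ : Fld) :
    contr (fun μ => pd μ (pd μ (gen ⟨φ, 0⟩ : Wick m))) + ((m : ℂ) ^ 2) • gen ⟨φ, 0⟩ = 0 := by
  simpa [contr, pd_gen] using gen_kleinGordon φ 0

theorem dQ_fh {m : ℝ} (μ ν : Fin 4) : dQ (fh μ ν : Wick m) = (-(Complex.I / 2)) •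
    (pd μ (fu ν) + pd ν (fu μ) - metric μ ν • contr fun ρ => pd ρ (fu ρ)) := by
  simp only [fh, fu, dQ_gen, varJet, pd_gen, contr]

theorem dQ_fu {m : ℝ} (μ : Fin 4) : dQ (fu μ : Wick m) = 0 := by
  simp only [fu, dQ_gen, varJet]

theorem dQ_fut {m : ℝ} (μ : Fin 4) : dQ (fut μ : Wick m) =
    Complex.I • ((contr fun ν => pd ν (fh μ ν)) + (m : ℂ) • fv μ) := by
  simp only [fh, fut, fv, dQ_gen, varJet, pd_gen, contr]

theorem dQ_fv {m : ℝ} (μ : Fin 4) :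
    dQ (fv μ : Wick m) = (-(Complex.I * m / 2)) • fu μ := by
  simp only [fu, fv, dQ_gen, varJet]

/-- A trivial coupling is `d_Q B + ∂_μ B^μ` with `B^μ` of ghost number `0` and `B` of the ghost
number that makes `d_Q B` of ghost number `0` (`d_Q` lowers the ghost number by one). -/
def TrivialCoupling {m : ℝ} (T : Wick m) : Prop :=
  ∃ B ∈ ghost (m := m) 1, ∃ C : Fin 4 → Wick m,
    (∀ μ, C μ ∈ ghost 0) ∧ T = dQ B + ∑ μ, pd μ (C μ)

/-- Two couplings are equivalent if they differ by a trivial coupling. -/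
def Equivalent {m : ℝ} (T T' : Wick m) : Prop := TrivialCoupling (T - T')

/-! The coupling and its current. Every repeated index is contracted with the Minkowski metric. -/

/-- The coupling `T^(b)` in the variables `H_{μν}`, `Φ`, `u_μ`, `ũ_μ`, `v_μ`. -/
def couplingH {m : ℝ} : Wick m :=
  -(contr3 fun μ ν ρ => fH μ ν * (pd μ (fv ρ)) * (pd ν (fv ρ)))
  + (2 : ℂ) • (contr3 fun μ ν ρ => fH μ ν * (pd μ (fv ν)) * (pd ρ (fv ρ)))
  - (2 : ℂ) • (contr3 fun μ ν ρ => fH μ ν * (pd μ (fv ρ)) * (pd ρ (fv ν)))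
  + (m : ℂ) • (
      (contr3 fun μ ν ρ => fH μ ν * (pd ρ (fH μ ν)) * fv ρ)
      - (2 : ℂ) • (contr3 fun μ ν ρ => fH μ ν * (pd ν (fH μ ρ)) * fv ρ)
      + (contr2 fun μ ν => fH μ ν * (pd μ fPhi) * fv ν)
      + (contr2 fun μ ρ => (pd ρ (fv ρ)) * fu μ * fut μ)
      - ((1 : ℂ) / 2) • (contr2 fun μ ν => (pd μ (fv ν)) * fu μ * fut ν)
      + (contr2 fun μ ν => (pd ν (fv μ)) * fu μ * fut ν)
      + (contr2 fun μ ν => fv ν * fu μ * (pd ν (fut μ)))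
      + (contr2 fun μ ν => fv μ * fu μ * (pd ν (fut ν)))
      - ((1 : ℂ) / 2) • (contr2 fun μ ν => fv ν * fu μ * (pd μ (fut ν)))
      + (2 : ℂ) • (contr2 fun μ ν => fv μ * fv ν * (pd μ (fv ν))))
  + ((m : ℂ) ^ 2) • (
      -(((1 : ℂ) / 3) • (contr3 fun μ ν ρ => fH μ ν * fH μ ρ * fH ν ρ))
      - (contr2 fun μ ν => fH μ ν * fu μ * fut ν)
      + ((3 : ℂ) / 2) • (contr2 fun μ ν => fH μ ν * fv μ * fv ν))

/-- The coupling `T^(b)` re-expressed in the variables `h_{μν}`, `u_μ`, `ũ_μ`, `v_μ`. -/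
def couplingB {m : ℝ} : Wick m :=
  -(contr3 fun μ ν ρ => fh μ ν * (pd μ (fv ρ)) * (pd ν (fv ρ)))
  + (2 : ℂ) • (contr3 fun μ ν ρ => fh μ ν * (pd μ (fv ν)) * (pd ρ (fv ρ)))
  - ((1 : ℂ) / 2) • (contr2 fun μ ρ => trh * (pd μ (fv μ)) * (pd ρ (fv ρ)))
  - (2 : ℂ) • (contr3 fun μ ν ρ => fh μ ν * (pd μ (fv ρ)) * (pd ρ (fv ν)))
  + ((1 : ℂ) / 2) • (contr2 fun μ ν => trh * (pd μ (fv ν)) * (pd ν (fv μ)))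
  + (m : ℂ) • (
      (contr3 fun μ ν ρ => fh μ ν * (pd ρ (fh μ ν)) * fv ρ)
      - ((1 : ℂ) / 2) • (contr fun ρ => trh * (pd ρ trh) * fv ρ)
      - (2 : ℂ) • (contr3 fun μ ν ρ => fh μ ν * (pd ν (fh μ ρ)) * fv ρ)
      + (contr2 fun ν ρ => fh ρ ν * (pd ν trh) * fv ρ)
      + ((1 : ℂ) / 2) • (contr2 fun μ ρ => trh * (pd μ (fh μ ρ)) * fv ρ)
      + (contr2 fun μ ρ => (pd ρ (fv ρ)) * fu μ * fut μ)
      - ((1 : ℂ) / 2) • (contr2 fun μ ν => (pd μ (fv ν)) * fu μ * fut ν)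
      + (contr2 fun μ ν => (pd ν (fv μ)) * fu μ * fut ν)
      + (contr2 fun μ ν => fv ν * fu μ * (pd ν (fut μ)))
      + (contr2 fun μ ν => fv μ * fu μ * (pd ν (fut ν)))
      - ((1 : ℂ) / 2) • (contr2 fun μ ν => fv ν * fu μ * (pd μ (fut ν)))
      + (2 : ℂ) • (contr2 fun μ ν => fv μ * fv ν * (pd μ (fv ν))))
  + ((m : ℂ) ^ 2) • (
      -(((1 : ℂ) / 3) • (contr3 fun μ ν ρ => fh μ ν * fh μ ρ * fh ν ρ))
      + ((1 : ℂ) / 4) • (contr2 fun μ ν => fh μ ν * fh μ ν * trh)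
      - ((1 : ℂ) / 24) • (trh * trh * trh)
      - (contr2 fun μ ν => fh μ ν * fu μ * fut ν)
      + ((1 : ℂ) / 4) • (contr fun μ => trh * fu μ * fut μ)
      + ((3 : ℂ) / 2) • (contr2 fun μ ν => fh μ ν * fv μ * fv ν)
      - ((1 : ℂ) / 4) • (contr fun μ => trh * fv μ * fv μ))

/-- The current `T^(b)_μ`, sorted by powers of the mass. -/
def currentB {m : ℝ} (μ : Fin 4) : Wick m :=
  (contr2 fun ν ρ => fu ν * (pd μ (fv ρ)) * (pd ν (fv ρ)))
  - (contr2 fun ν ρ => fu ν * (pd ν (fv μ)) * (pd ρ (fv ρ)))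
  - ((1 : ℂ) / 2) • (contr2 fun ν ρ => fu ν * (pd μ (fv ν)) * (pd ρ (fv ρ)))
  + (contr2 fun ν ρ => fu ν * (pd ν (fv ρ)) * (pd ρ (fv μ)))
  + ((1 : ℂ) / 2) • (contr2 fun ν ρ => fu ν * (pd μ (fv ρ)) * (pd ρ (fv ν)))
  + ((1 : ℂ) / 2) • (contr2 fun ν ρ => fu ν * fv ν * (pd μ (pd ρ (fv ρ))))
  - ((1 : ℂ) / 2) • (contr2 fun ν ρ => fu ν * fv ρ * (pd μ (pd ρ (fv ν))))
  - ((1 : ℂ) / 2) • (contr2 fun ν ρ => fu μ * (pd ν (fv ρ)) * (pd ν (fv ρ)))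
  + ((1 : ℂ) / 2) • (contr2 fun ν ρ => fu μ * (pd ν (fv ν)) * (pd ρ (fv ρ)))
  - ((1 : ℂ) / 2) • (contr2 fun ν ρ => fu μ * (pd ν (fv ρ)) * (pd ρ (fv ν)))
  - ((1 : ℂ) / 2) • (contr2 fun ν ρ => (pd μ (fu ν)) * fv ν * (pd ρ (fv ρ)))
  + ((1 : ℂ) / 2) • (contr2 fun ν ρ => (pd μ (fu ν)) * fv ρ * (pd ρ (fv ν)))
  + (m : ℂ) • (
      -(contr2 fun ν ρ => fu ν * (pd ρ (fh μ ρ)) * fv ν)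
      - (contr2 fun ν ρ => fu ν * fh μ ν * (pd ρ (fv ρ)))
      + (contr2 fun ν ρ => fu ν * fh μ ρ * (pd ν (fv ρ)))
      + (contr2 fun ν ρ => fu ν * fh ν ρ * (pd ρ (fv μ)))
      - ((1 : ℂ) / 2) • (contr fun ν => fu ν * trh * (pd ν (fv μ)))
      - (contr2 fun ν ρ => fu ν * (pd ρ (fh μ ν)) * fv ρ)
      + (contr2 fun ν ρ => fu ν * (pd ν (fh μ ρ)) * fv ρ)
      + ((1 : ℂ) / 2) • (contr2 fun ν ρ => fu ν * (pd μ (fh ν ρ)) * fv ρ)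
      - ((1 : ℂ) / 4) • (contr fun ν => fu ν * (pd μ trh) * fv ν)
      - ((1 : ℂ) / 2) • (contr fun ν => fu ν * (pd ν trh) * fv μ)
      + ((1 : ℂ) / 4) • (contr fun ν => fu ν * trh * (pd μ (fv ν)))
      - ((1 : ℂ) / 2) • (contr2 fun ν ρ => fu ν * fh ν ρ * (pd μ (fv ρ)))
      - (contr2 fun ν ρ => fu μ * fh ν ρ * (pd ν (fv ρ)))
      + ((1 : ℂ) / 2) • (contr fun ρ => fu μ * trh * (pd ρ (fv ρ)))
      + ((1 : ℂ) / 2) • (contr fun ρ => fu μ * (pd ρ trh) * fv ρ)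
      - ((1 : ℂ) / 2) • (contr2 fun ν ρ => fu μ * (pd ν (fh ν ρ)) * fv ρ)
      + (contr2 fun ν ρ => (pd ρ (fu ν)) * fh μ ρ * fv ν)
      + ((1 : ℂ) / 2) • (contr2 fun ν ρ => (pd μ (fu ν)) * fh ν ρ * fv ρ)
      - ((1 : ℂ) / 4) • (contr fun ν => (pd μ (fu ν)) * trh * fv ν))
  + ((m : ℂ) ^ 2) • (
      -(((5 : ℂ) / 2) • (contr fun ν => fu ν * fv μ * fv ν))
      + (contr2 fun ν ρ => fu ν * fh μ ρ * fh ν ρ)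
      - ((1 : ℂ) / 2) • (contr fun ν => fu ν * fh μ ν * trh)
      - ((1 : ℂ) / 4) • (contr2 fun ν ρ => fu μ * fh ν ρ * fh ν ρ)
      + ((1 : ℂ) / 8) • (fu μ * trh * trh)
      + ((1 : ℂ) / 2) • (contr fun ν => fu μ * fv ν * fv ν)
      - ((3 : ℂ) / 4) • (contr fun ν => fu μ * fu ν * fut ν))

end MassiveGravity

end

noncomputable section

namespace MassiveGravity

variable {m : ℝ}

/-! ### Contractions -/

/-! Both claims are identities between cubic Wick polynomials whose indices are all contracted.

For (i), substituting H = h - ¼ηh (with h the trace) reproduces `couplingB` term by term, apart from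
the remainder ¼h(∂_μ v_ν)(∂^μ v^ν) - ⅛m²h v². This is the divergence of ¼h v^ν ∂_μ v_ν - ⅛(∂_μ h)v^ν
v_ν: the cross terms (∂_μ h)v_ν ∂^μ v^ν cancel, and the Klein-Gordon equation gives -¼m² + ⅛m² =
-⅛m². Hence a pure divergence suffices and B = 0.

For (ii), both sides are expanded by the Leibniz rules and compared. Besides linear algebra, only
four facts enter: graded commutativity, the symmetry of h_{μν}, the Klein-Gordon equation and the
renaming of dummy indices.

The renaming is the delicate point, since two equal contractions may have different summands. No
term carries more than three index pairs, so every term can be written as a `contr3`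
(`contr2_eq_contr3`) and all of them merged under one contraction. By `contr3_eq_zero` it is then
enough that the sum of the summand over all permutations of (μ, ν, ρ) vanishes for fixed indices.
With the monomials in normal order this is a linear identity, left to `module`. The Klein-Gordon
equation (`contr3_gen_mul` and its variants) needs an actual sum, so it is applied before the
indices are fixed. -/

theorem contr_add (f g : Fin 4 → Wick m) :
    contr (fun μ => f μ + g μ) = contr f + contr g := by
  simp [contr, smul_add, Finset.sum_add_distrib]

theorem contr_sub (f g : Fin 4 → Wick m) :
    contr (fun μ => f μ - g μ) = contr f - contr g := by
  simp [contr, smul_sub, Finset.sum_sub_distrib]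

theorem contr_neg (f : Fin 4 → Wick m) : contr (fun μ => -f μ) = -contr f := by
  simp [contr]

theorem contr_smul (c : ℂ) (f : Fin 4 → Wick m) : contr (fun μ => c • f μ) = c • contr f := by
  simp [contr, Finset.smul_sum, smul_comm c]

theorem contr_zero : contr (fun _ => (0 : Wick m)) = 0 := by
  simp [contr]

theorem contr_mul (f : Fin 4 → Wick m) (x : Wick m) : contr f * x = contr fun μ => f μ * x := by
  simp [contr, Finset.sum_mul]

theorem mul_contr (x : Wick m) (f : Fin 4 → Wick m) : x * contr f = contr fun μ => x * f μ := by
  simp [contr, Finset.mul_sum]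

theorem contr_comm (f : Fin 4 → Fin 4 → Wick m) :
    (contr fun μ => contr fun ν => f μ ν) = contr fun ν => contr fun μ => f μ ν := by
  simp only [contr, Finset.smul_sum]
  rw [Finset.sum_comm]
  simp only [smul_comm (eta _) (eta _)]

theorem eta_mul_self (μ : Fin 4) : eta μ * eta μ = 1 := by
  fin_cases μ <;> simp [eta]

/-- The metric is diagonal with entries ±1 and hence its own inverse: the sign from the contraction
cancels the sign of the surviving entry. -/
theorem contr_metric_right (μ : Fin 4) (f : Fin 4 → Wick m) :
    (contr fun ν => metric μ ν • f ν) = f μ := by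
  simp only [contr, metric, Matrix.diagonal_apply, ite_smul, smul_ite, zero_smul, smul_zero,
    Finset.sum_ite_eq, Finset.mem_univ, if_true, smul_smul, eta_mul_self, one_smul]

theorem contr_metric_left (ν : Fin 4) (f : Fin 4 → Wick m) :
    (contr fun μ => metric μ ν • f μ) = f ν := by
  simp only [contr, metric, Matrix.diagonal_apply, ite_smul, smul_ite, zero_smul, smul_zero,
    Finset.sum_ite_eq', Finset.mem_univ, if_true, smul_smul, eta_mul_self, one_smul]

theorem contr_metric_self (x : Wick m) : (contr fun μ => metric μ μ • x) = (4 : ℂ) • x := by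
  simp only [contr, metric, Matrix.diagonal_apply_eq, smul_smul, eta_mul_self, one_smul,
    Fin.sum_univ_four]
  module

theorem contr_eta_smul (x : Wick m) : (contr fun μ => eta μ • x) = (4 : ℂ) • x := by
  simp only [contr, smul_smul, eta_mul_self, one_smul, Fin.sum_univ_four]
  module

theorem contr3_add (f g : Fin 4 → Fin 4 → Fin 4 → Wick m) :
    contr3 f + contr3 g = contr3 fun μ ν ρ => f μ ν ρ + g μ ν ρ := by
  simp only [contr3, contr_add]

theorem contr3_sub (f g : Fin 4 → Fin 4 → Fin 4 → Wick m) :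
    contr3 f - contr3 g = contr3 fun μ ν ρ => f μ ν ρ - g μ ν ρ := by
  simp only [contr3, contr_sub]

theorem contr3_neg (f : Fin 4 → Fin 4 → Fin 4 → Wick m) :
    -contr3 f = contr3 fun μ ν ρ => -f μ ν ρ := by
  simp only [contr3, contr_neg]

theorem contr3_smul (c : ℂ) (f : Fin 4 → Fin 4 → Fin 4 → Wick m) :
    c • contr3 f = contr3 fun μ ν ρ => c • f μ ν ρ := by
  simp only [contr3, contr_smul]

/-- A dummy third pair is inserted with weight `eta ρ / 4`; contracting it gives ∑ (eta ρ)²/4 = 1.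
This lets terms with two and three index pairs be added under one contraction. -/
theorem contr2_eq_contr3 (f : Fin 4 → Fin 4 → Wick m) :
    contr2 f = contr3 fun μ ν ρ => (eta ρ / 4) • f μ ν := by
  have h (x : Wick m) : (contr fun ρ => (eta ρ / 4) • x) = x := by
    have : (fun ρ => (eta ρ / 4) • x) = fun ρ => ((1 : ℂ) / 4) • eta ρ • x := by
      funext ρ; module
    rw [this, contr_smul, contr_eta_smul]
    module
  simp only [contr2, contr3, h]

/-- A contraction of three pairs of indices vanishes if its symmetrization in the dummy indices
does. -/
theorem contr3_eq_zero {f : Fin 4 → Fin 4 → Fin 4 → Wick m}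
    (h : ∀ μ ν ρ, f μ ν ρ + f ν μ ρ + (f μ ρ ν + f ρ μ ν) + (f ν ρ μ + f ρ ν μ) = 0) :
    contr3 f = 0 := by
  have swap1 (g : Fin 4 → Fin 4 → Fin 4 → Wick m) :
      contr3 (fun μ ν ρ => g ν μ ρ) = contr3 g := contr_comm _
  have swap2 (g : Fin 4 → Fin 4 → Fin 4 → Wick m) :
      contr3 (fun μ ν ρ => g μ ρ ν) = contr3 g := by
    simp only [contr3]
    congr 1
    funext μ
    exact contr_comm _
  -- Two transpositions generate all renamings of the three dummy indices. The coefficients 3, 2, 2,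
  -- 1, 1 below count how many of the six terms use each swap on the way back to `f`.
  have h1 := swap1 f
  have h2 := swap2 f
  have h3 := swap2 fun μ ν ρ => f ν μ ρ
  have h4 := swap1 fun μ ν ρ => f μ ρ ν
  have h5 := swap1 fun μ ν ρ => f ρ μ ν
  have hs : contr3 (fun μ ν ρ =>
      f μ ν ρ + f ν μ ρ + (f μ ρ ν + f ρ μ ν) + (f ν ρ μ + f ρ ν μ)) = 0 := by
    simp only [h, contr3, contr_zero]
  simp only [← contr3_add] at hs
  have h6 : (6 : ℂ) • contr3 f = 0 := by
    linear_combination (norm := module)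
      hs - (3 : ℂ) • h1 - (2 : ℂ) • h2 - (2 : ℂ) • h3 - h4 - h5
  simpa using h6

/-! ### Products of differentiated fields -/

/-- Bosonic generators carry no Koszul sign against any generator, so they are central. -/
theorem mul_gen_h (x : Wick m) (μ ν : Fin 4) (I : Multiset (Fin 4)) :
    x * gen ⟨.h μ ν, I⟩ = gen ⟨.h μ ν, I⟩ * x := by
  induction x using wick_induction with
  | hc c => exact Algebra.commutes _ _
  | hg a => rw [gen_comm]; simp [Fld.koszul, Fld.fermi]
  | hm x y hx hy => rw [mul_assoc, hy, ← mul_assoc, hx, mul_assoc]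
  | ha x y hx hy => rw [add_mul, mul_add, hx, hy]

theorem mul_gen_v (x : Wick m) (μ : Fin 4) (I : Multiset (Fin 4)) :
    x * gen ⟨.v μ, I⟩ = gen ⟨.v μ, I⟩ * x := by
  induction x using wick_induction with
  | hc c => exact Algebra.commutes _ _
  | hg a => rw [gen_comm]; simp [Fld.koszul, Fld.fermi]
  | hm x y hx hy => rw [mul_assoc, hy, ← mul_assoc, hx, mul_assoc]
  | ha x y hx hy => rw [add_mul, mul_add, hx, hy]

theorem gen_u_mul_gen_u (μ ν : Fin 4) (I J : Multiset (Fin 4)) :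
    (gen ⟨.u μ, I⟩ * gen ⟨.u ν, J⟩ : Wick m) = -(gen ⟨.u ν, J⟩ * gen ⟨.u μ, I⟩) := by
  rw [gen_comm]; simp [Fld.koszul, Fld.fermi]

/-- Read off from the upper right entry of the triangular matrix `dQHom`. Peeling off one generator
at a time replaces the ghost number hypothesis of `dQ_mul` by an explicit sign, so `simp` can
differentiate right-associated monomials. -/
theorem dQ_gen_mul (a : Jet) (y : Wick m) :
    dQ (gen a * y) = varJet a * y + a.fld.sgn • (gen a * dQ y) := by
  change dQHom m (gen a * y) 0 1 = varJet a * y + a.fld.sgn • (gen a * dQHom m y 0 1)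
  rw [map_mul, Matrix.mul_apply, Fin.sum_univ_two, (dQHom_diag m y).2, dQHom_gen]
  simp [add_comm]

theorem dQ_h_mul (μ ν : Fin 4) (I : Multiset (Fin 4)) (y : Wick m) :
    dQ (gen ⟨.h μ ν, I⟩ * y) = varJet ⟨.h μ ν, I⟩ * y + gen ⟨.h μ ν, I⟩ * dQ y := by
  simp [dQ_gen_mul, Fld.sgn, Fld.fermi]

theorem dQ_v_mul (μ : Fin 4) (I : Multiset (Fin 4)) (y : Wick m) :
    dQ (gen ⟨.v μ, I⟩ * y) = varJet ⟨.v μ, I⟩ * y + gen ⟨.v μ, I⟩ * dQ y := by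
  simp [dQ_gen_mul, Fld.sgn, Fld.fermi]

theorem dQ_u_mul (μ : Fin 4) (I : Multiset (Fin 4)) (y : Wick m) :
    dQ (gen ⟨.u μ, I⟩ * y) = -(gen ⟨.u μ, I⟩ * dQ y) := by
  simp [dQ_gen_mul, Fld.sgn, Fld.fermi, varJet]

theorem dQ_contr (f : Fin 4 → Wick m) : dQ (contr f) = contr fun μ => dQ (f μ) := by
  simp [contr]

theorem pd_contr (κ : Fin 4) (f : Fin 4 → Wick m) : pd κ (contr f) = contr fun μ => pd κ (f μ) := by
  simp [contr]

theorem varJet_h (μ ν : Fin 4) (I : Multiset (Fin 4)) :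
    (varJet ⟨.h μ ν, I⟩ : Wick m) = (-(Complex.I / 2)) • (gen ⟨.u ν, μ ::ₘ I⟩
      + gen ⟨.u μ, ν ::ₘ I⟩ - metric μ ν • contr fun ρ => gen ⟨.u ρ, ρ ::ₘ I⟩) := rfl

theorem varJet_ut (μ : Fin 4) (I : Multiset (Fin 4)) :
    (varJet ⟨.ut μ, I⟩ : Wick m) = Complex.I • ((contr fun ν => gen ⟨.h μ ν, ν ::ₘ I⟩)
      + (m : ℂ) • gen ⟨.v μ, I⟩) := rfl

theorem varJet_v (μ : Fin 4) (I : Multiset (Fin 4)) :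
    (varJet ⟨.v μ, I⟩ : Wick m) = (-(Complex.I * m / 2)) • gen ⟨.u μ, I⟩ := rfl

theorem contr_gen (φ : Fld) (I : Multiset (Fin 4)) :
    (contr fun μ => (gen ⟨φ, μ ::ₘ μ ::ₘ I⟩ : Wick m)) = -(((m : ℂ) ^ 2) • gen ⟨φ, I⟩) :=
  eq_neg_of_add_eq_zero_left (gen_kleinGordon φ I)

theorem contr_gen_mul (φ : Fld) (I : Multiset (Fin 4)) (x : Wick m) :
    (contr fun μ => (gen ⟨φ, μ ::ₘ μ ::ₘ I⟩ * x : Wick m))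
      = -(((m : ℂ) ^ 2) • (gen ⟨φ, I⟩ * x)) := by
  rw [← contr_mul, contr_gen, neg_mul, smul_mul_assoc]

/-! ### Collecting contractions -/

theorem contr_contr_contr (f : Fin 4 → Fin 4 → Fin 4 → Wick m) :
    (contr fun μ => contr fun ν => contr fun ρ => f μ ν ρ) = contr3 f := rfl

theorem contr_contr (f : Fin 4 → Fin 4 → Wick m) :
    (contr fun μ => contr fun ν => f μ ν) = contr3 fun μ ν ρ => (eta ρ / 4) • f μ ν :=
  contr2_eq_contr3 f

/-- The outermost pair occurs only in the doubled derivative, so its sum can be moved innermost,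
where it is the d'Alembertian of a single factor. Further derivatives may remain in `I`. -/
theorem contr3_gen_mul (φ : Fin 4 → Fin 4 → Fld) (I : Fin 4 → Fin 4 → Multiset (Fin 4))
    (x : Fin 4 → Fin 4 → Wick m) :
    (contr3 fun μ ν ρ => gen ⟨φ ν ρ, μ ::ₘ μ ::ₘ I ν ρ⟩ * x ν ρ)
      = -(((m : ℂ) ^ 2) • contr fun ν => contr fun ρ => gen ⟨φ ν ρ, I ν ρ⟩ * x ν ρ) := by
  simp only [contr3]
  rw [contr_comm]
  simp only [contr_comm (fun μ ρ => gen ⟨φ _ ρ, μ ::ₘ μ ::ₘ I _ ρ⟩ * x _ ρ), contr_gen_mul,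
    contr_neg, contr_smul]

/-- The Klein-Gordon equation applied to one factor of a contracted product. -/
theorem contr3_mul_gen_mul (φ : Fin 4 → Fin 4 → Fld) (I : Fin 4 → Fin 4 → Multiset (Fin 4))
    (x y : Fin 4 → Fin 4 → Wick m) :
    (contr3 fun μ ν ρ => x ν ρ * (gen ⟨φ ν ρ, μ ::ₘ μ ::ₘ I ν ρ⟩ * y ν ρ))
      = -(((m : ℂ) ^ 2) • contr fun ν => contr fun ρ => x ν ρ * (gen ⟨φ ν ρ, I ν ρ⟩ * y ν ρ)) := by
  simp only [contr3]
  rw [contr_comm]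
  simp only [contr_comm (fun μ ρ => x _ ρ * (gen ⟨φ _ ρ, μ ::ₘ μ ::ₘ I _ ρ⟩ * y _ ρ)),
    ← mul_contr, contr_gen_mul, mul_neg, mul_smul_comm, contr_neg, contr_smul]

theorem contr3_mul_gen (φ : Fin 4 → Fin 4 → Fld) (I : Fin 4 → Fin 4 → Multiset (Fin 4))
    (x y : Fin 4 → Fin 4 → Wick m) :
    (contr3 fun μ ν ρ => x ν ρ * (y ν ρ * gen ⟨φ ν ρ, μ ::ₘ μ ::ₘ I ν ρ⟩))
      = -(((m : ℂ) ^ 2) • contr fun ν => contr fun ρ => x ν ρ * (y ν ρ * gen ⟨φ ν ρ, I ν ρ⟩)) := by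
  simpa only [mul_one, mul_assoc] using contr3_mul_gen_mul φ I (fun ν ρ => x ν ρ * y ν ρ)
    fun _ _ => 1

/-! ### Normal ordering of monomials -/

theorem gen_u_mul_gen_h (μ ν κ : Fin 4) (I J : Multiset (Fin 4)) :
    (gen ⟨.u κ, J⟩ * gen ⟨.h μ ν, I⟩ : Wick m) = gen ⟨.h μ ν, I⟩ * gen ⟨.u κ, J⟩ :=
  mul_gen_h _ _ _ _

theorem gen_u_mul_gen_h_mul (μ ν κ : Fin 4) (I J : Multiset (Fin 4)) (x : Wick m) :
    gen ⟨.u κ, J⟩ * (gen ⟨.h μ ν, I⟩ * x) = gen ⟨.h μ ν, I⟩ * (gen ⟨.u κ, J⟩ * x) := by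
  rw [← mul_assoc, mul_gen_h, mul_assoc]

theorem gen_v_mul_gen_h_mul (μ ν κ : Fin 4) (I J : Multiset (Fin 4)) (x : Wick m) :
    gen ⟨.v κ, J⟩ * (gen ⟨.h μ ν, I⟩ * x) = gen ⟨.h μ ν, I⟩ * (gen ⟨.v κ, J⟩ * x) := by
  rw [← mul_assoc, mul_gen_h, mul_assoc]

theorem gen_u_mul_gen_v (κ μ : Fin 4) (I J : Multiset (Fin 4)) :
    (gen ⟨.u κ, J⟩ * gen ⟨.v μ, I⟩ : Wick m) = gen ⟨.v μ, I⟩ * gen ⟨.u κ, J⟩ := mul_gen_v _ _ _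

theorem gen_u_mul_gen_v_mul (κ μ : Fin 4) (I J : Multiset (Fin 4)) (x : Wick m) :
    gen ⟨.u κ, J⟩ * (gen ⟨.v μ, I⟩ * x) = gen ⟨.v μ, I⟩ * (gen ⟨.u κ, J⟩ * x) := by
  rw [← mul_assoc, mul_gen_v, mul_assoc]

theorem gen_h_left_comm (μ ν κ τ : Fin 4) (I J : Multiset (Fin 4)) (x : Wick m) :
    gen ⟨.h κ τ, J⟩ * (gen ⟨.h μ ν, I⟩ * x) = gen ⟨.h μ ν, I⟩ * (gen ⟨.h κ τ, J⟩ * x) := by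
  rw [← mul_assoc, mul_gen_h, mul_assoc]

theorem gen_v_left_comm (κ μ : Fin 4) (I J : Multiset (Fin 4)) (x : Wick m) :
    gen ⟨.v κ, J⟩ * (gen ⟨.v μ, I⟩ * x) = gen ⟨.v μ, I⟩ * (gen ⟨.v κ, J⟩ * x) := by
  rw [← mul_assoc, mul_gen_v, mul_assoc]

theorem gen_u_mul_deriv_u_mul (μ ν κ : Fin 4) (x : Wick m) :
    gen ⟨.u μ, 0⟩ * (gen ⟨.u ν, κ ::ₘ 0⟩ * x) = -(gen ⟨.u ν, κ ::ₘ 0⟩ * (gen ⟨.u μ, 0⟩ * x)) := by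
  rw [← mul_assoc, gen_u_mul_gen_u, neg_mul, mul_assoc]

theorem gen_u_anticomm (μ ν : Fin 4) (x : Wick m) :
    gen ⟨.u μ, 0⟩ * (gen ⟨.u ν, 0⟩ * x) = -(gen ⟨.u ν, 0⟩ * (gen ⟨.u μ, 0⟩ * x)) := by
  rw [← mul_assoc, gen_u_mul_gen_u, neg_mul, mul_assoc]

/-- Anticommutation makes the product equal to its negative, and 2 is invertible. This is needed
when two of the fixed indices on u coincide in the symmetrized sum. -/
theorem gen_u_mul_self (μ : Fin 4) (x : Wick m) : gen ⟨.u μ, 0⟩ * (gen ⟨.u μ, 0⟩ * x) = 0 := by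
  have h := gen_u_anticomm μ μ x
  have h2 : (2 : ℂ) • (gen ⟨.u μ, 0⟩ * (gen ⟨.u μ, 0⟩ * x)) = 0 := by
    linear_combination (norm := module) h
  simpa using h2

theorem gen_h_comm (μ ν κ τ : Fin 4) (I J : Multiset (Fin 4)) :
    (gen ⟨.h κ τ, J⟩ * gen ⟨.h μ ν, I⟩ : Wick m) = gen ⟨.h μ ν, I⟩ * gen ⟨.h κ τ, J⟩ :=
  mul_gen_h _ _ _ _

theorem gen_v_comm (κ μ : Fin 4) (I J : Multiset (Fin 4)) :
    (gen ⟨.v κ, J⟩ * gen ⟨.v μ, I⟩ : Wick m) = gen ⟨.v μ, I⟩ * gen ⟨.v κ, J⟩ :=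
  mul_gen_v _ _ _

/-! ### The two forms of the coupling -/

theorem gen_mul_gen_mul_gen_mem_ghost (a b c : Jet) :
    (gen a * gen b * gen c : Wick m) ∈ ghost (a.fld.gh + b.fld.gh + c.fld.gh) :=
  Submodule.subset_span ⟨[a, b, c], by simp [add_assoc], by simp [mul_assoc]⟩

/-- The vector whose divergence is the difference of the two forms of the coupling. -/
def couplingShift (μ : Fin 4) : Wick m :=
  ((1 : ℂ) / 4) • (contr fun ν => trh * fv ν * pd μ (fv ν))
    - ((1 : ℂ) / 8) • (contr fun ν => pd μ trh * fv ν * fv ν)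

theorem couplingShift_mem_ghost (μ : Fin 4) : (couplingShift μ : Wick m) ∈ ghost 0 := by
  simp only [couplingShift, trh, fh, fv, pd_contr, pd_gen, contr_mul]
  simp only [contr]
  have h (a b : Fin 4) (c d : Fin 4) (I J K : Multiset (Fin 4)) :
      (gen ⟨.h a b, I⟩ * gen ⟨.v c, J⟩ * gen ⟨.v d, K⟩ : Wick m) ∈ ghost 0 := by
    simpa [Fld.gh] using
      gen_mul_gen_mul_gen_mem_ghost (m := m) ⟨.h a b, I⟩ ⟨.v c, J⟩ ⟨.v d, K⟩
  exact Submodule.sub_mem _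
    (Submodule.smul_mem _ _ (Submodule.sum_mem _ fun ν _ => Submodule.smul_mem _ _
      (Submodule.sum_mem _ fun ρ _ => Submodule.smul_mem _ _ (h _ _ _ _ _ _ _))))
    (Submodule.smul_mem _ _ (Submodule.sum_mem _ fun ν _ => Submodule.smul_mem _ _
      (Submodule.sum_mem _ fun ρ _ => Submodule.smul_mem _ _ (h _ _ _ _ _ _ _))))

set_option maxHeartbeats 1000000 in
theorem couplingH_sub_couplingB :
    couplingH (m := m) - couplingB = contr fun μ => pd μ (couplingShift μ) := by
  rw [← sub_eq_zero]
  simp only [couplingH, couplingB, couplingShift, fH, fPhi, mul_smul, contr3, contr2, trh, fh, fu,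
    fut, fv, pd_contr, pd_gen, pd_mul, mul_assoc, contr_mul, mul_contr, map_sub, map_smul, sub_mul,
    mul_add, mul_sub, smul_mul_assoc, mul_smul_comm, smul_neg, contr_add, contr_sub, contr_smul,
    smul_add, smul_sub, neg_sub, contr_metric_right, contr_metric_self]
  simp only [contr_contr_contr, contr3_gen_mul, contr3_mul_gen]
  simp only [contr_contr, contr3_add, contr3_sub, contr3_neg, contr3_smul]
  refine contr3_eq_zero fun μ ν ρ => ?_
  have h1 (I : Multiset (Fin 4)) : (gen ⟨.h ν μ, I⟩ : Wick m) = gen ⟨.h μ ν, I⟩ := gen_symm _ _ _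
  have h2 (I : Multiset (Fin 4)) : (gen ⟨.h ρ μ, I⟩ : Wick m) = gen ⟨.h μ ρ, I⟩ := gen_symm _ _ _
  have h3 (I : Multiset (Fin 4)) : (gen ⟨.h ρ ν, I⟩ : Wick m) = gen ⟨.h ν ρ, I⟩ := gen_symm _ _ _
  simp only [h1, h2, h3]
  simp only [gen_h_comm, gen_v_comm, gen_h_left_comm, gen_v_left_comm]
  module

theorem equivalent_couplingH_couplingB : Equivalent (couplingH (m := m)) couplingB := by
  -- `TrivialCoupling` sums over μ without a metric, so the factor `eta μ` raises the index of the
  -- shift.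
  refine ⟨0, Submodule.zero_mem _, fun μ => eta μ • couplingShift μ,
    fun μ => Submodule.smul_mem _ _ (couplingShift_mem_ghost μ), ?_⟩
  rw [couplingH_sub_couplingB]
  simp [contr]

set_option maxHeartbeats 4000000 in
/-- First-order gauge invariance of the coupling. -/
theorem dQ_couplingB :
    dQ (couplingB (m := m)) = Complex.I • contr fun μ => pd μ (currentB μ) := by
  rw [← sub_eq_zero]
  simp only [couplingB, currentB, contr3, contr2, trh, fh, fu, fut, fv, pd_contr, pd_gen, pd_mul,
    mul_assoc, contr_mul, mul_contr, map_add, map_sub, map_neg, map_smul, dQ_contr, dQ_h_mul,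
    dQ_v_mul, dQ_u_mul, dQ_gen, varJet_h, varJet_ut, varJet_v, add_mul, sub_mul, mul_add, mul_sub,
    smul_mul_assoc, mul_smul_comm, mul_neg, neg_mul, smul_neg, neg_neg, neg_smul, contr_neg,
    contr_add, contr_sub, contr_smul, smul_add, smul_sub, neg_add, neg_sub, contr_metric_left,
    contr_metric_right, contr_metric_self]
  simp only [contr_contr_contr, contr3_gen_mul, contr3_mul_gen_mul, contr3_mul_gen]
  simp only [gen_u_mul_gen_h, gen_u_mul_gen_h_mul, gen_v_mul_gen_h_mul, gen_u_mul_gen_v,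
    gen_u_mul_gen_v_mul]
  simp only [contr_contr, contr3_add, contr3_sub, contr3_neg, contr3_smul]
  refine contr3_eq_zero fun μ ν ρ => ?_
  have h1 (I : Multiset (Fin 4)) : (gen ⟨.h ν μ, I⟩ : Wick m) = gen ⟨.h μ ν, I⟩ := gen_symm _ _ _
  have h2 (I : Multiset (Fin 4)) : (gen ⟨.h ρ μ, I⟩ : Wick m) = gen ⟨.h μ ρ, I⟩ := gen_symm _ _ _
  have h3 (I : Multiset (Fin 4)) : (gen ⟨.h ρ ν, I⟩ : Wick m) = gen ⟨.h ν ρ, I⟩ := gen_symm _ _ _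
  have k1 (I : Multiset (Fin 4)) : ν ::ₘ μ ::ₘ I = μ ::ₘ ν ::ₘ I := Multiset.cons_swap _ _ _
  have k2 (I : Multiset (Fin 4)) : ρ ::ₘ μ ::ₘ I = μ ::ₘ ρ ::ₘ I := Multiset.cons_swap _ _ _
  have k3 (I : Multiset (Fin 4)) : ρ ::ₘ ν ::ₘ I = ν ::ₘ ρ ::ₘ I := Multiset.cons_swap _ _ _
  -- The symmetry of h and of iterated derivatives is oriented so that indices appear in the order
  -- μ, ν, ρ.
  simp only [h1, h2, h3, k1, k2, k3]
  -- Commutation of bosons is a permutation that `simp` orders by itself. Anticommutation of u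
  -- changes the sign and would loop, so it is given only for pairs out of order.
  simp only [gen_h_left_comm, gen_v_left_comm, gen_u_mul_deriv_u_mul, gen_u_mul_self,
    gen_u_anticomm ν μ, gen_u_anticomm ρ μ, gen_u_anticomm ρ ν]
  module

end MassiveGravity

end

theorem mainTheorem3 (m : ℝ) (hm : 0 < m) :
    MassiveGravity.Equivalent (MassiveGravity.couplingH (m := m)) MassiveGravity.couplingB ∧
      MassiveGravity.dQ (MassiveGravity.couplingB (m := m)) =
        Complex.I • MassiveGravity.contr fun μ =>
          MassiveGravity.pd μ (MassiveGravity.currentB μ) := by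
  exact ⟨MassiveGravity.equivalent_couplingH_couplingB, MassiveGravity.dQ_couplingB⟩
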